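/- Let $\mathcal C$ be a symmetric monoidal category. An endo-profunctor on $\mathcal C$ is a functor $F:\mathcal C^{op}\times\mathcal C\to\mathbf{Set}$. A (right) strength on $F$ is a family of maps $\mathrm{st}_Z: F(X,Y)\to F(X\otimes Z,Y\otimes Z)$, natural in $X,Y$, dinatural in $Z$, with $F(\alpha_{X,Z,Z'},\alpha_{Y,Z,Z'}^{-1})\circ \mathrm{st}_{Z\otimes Z'}=\mathrm{st}_{Z'}\circ\mathrm{st}_Z$ and $\mathrm{st}_I=F(\rho_X,\rho_Y^{-1})$, where $\alpha_{X,Y,Z}:(X\otimes Y)\otimes Z\to X\otimes(Y\otimes Z)$, $\lambda$, $\rho$ are the associator and unitors. An arrow on $\mathcal C$ is a monoid in the category of strong profunctors under profunctor composition, i.e. an endo-profunctor $A$ with a strength $\mathrm{st}$, a natural transformation $\mathrm{pure}:\mathrm{Hom}(X,Y)\to A(X,Y)$ and maps $\mathrm{comp}:A(X,Y)\times A(Y,Z)\to A(X,Z)$, $(a,b)\mapsto a\ggg b$, natural in $X,Z$ and dinatural in $Y$, such that $\ggg$ is associative, $\mathrm{pure}(f)\ggg a=A(f,\mathrm{id})(a)$,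 $a\ggg\mathrm{pure}(f)=A(\mathrm{id},f)(a)$, $\mathrm{st}_Z(\mathrm{pure}(f))=\mathrm{pure}(f\otimes Z)$ and $\mathrm{st}_Z(a\ggg b)=\mathrm{st}_Z(a)\ggg\mathrm{st}_Z(b)$. With $\sigma$ the symmetry, the induced left strength is $\mathrm{st}'_Z=A(\sigma_{Z,X},\sigma_{Y,Z})\circ\mathrm{st}_Z:A(X,Y)\to A(Z\otimes X,Z\otimes Y)$. The arrow is commutative if $\mathrm{st}_{X'}(a)\ggg\mathrm{st}'_Y(a')=\mathrm{st}'_X(a')\ggg\mathrm{st}_{Y'}(a)$ for all $a\in A(X,Y)$, $a'\in A(X',Y')$. Let $A$ be a commutative arrow on $\mathcal C$, with values in sets of a universe large enough for coends over $\mathcal C$ to exist. Let $\mathrm{Optic}(A)$ be the endo-profunctor on the symmetric monoidal category $\mathcal C\times\mathcal C^{op}$ (with componentwise structure) defined by $$\mathrm{Optic}(A)\big((X,S),(Y,R)\big)=\int^{P\in\mathcal C}A(X,P\otimes Y)\times A(P\otimes R,S),$$ and write $[P,a,b]$ for the class of $(a,b)\in A(X,P\otimes Y)\times A(P\otimes R,S)$.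 Then $\mathrm{Optic}(A)$ is a commutative arrow on $\mathcal C\times\mathcal C^{op}$. More precisely, there is a commutative arrow structure on this profunctor such that: * for $f:X\to Y$ and $g:R\to S$ in $\mathcal C$, $\ \mathrm{pure}(f,g)=[I,\ \mathrm{pure}(\lambda_Y^{-1}\circ f),\ \mathrm{pure}(g\circ\lambda_R)]$; * for $[P,a,b]\in\mathrm{Optic}(A)((X,S),(Y,R))$ and $[Q,a',b']\in\mathrm{Optic}(A)((Y,R),(Z,T))$, $\ [P,a,b]\ggg[Q,a',b']=\big[P\otimes Q,\ A(\mathrm{id},\alpha_{P,Q,Z}^{-1})(a\ggg\mathrm{st}'_P(a')),\ A(\alpha_{P,Q,T},\mathrm{id})(\mathrm{st}'_P(b')\ggg b)\big]$; * for $[P,a,b]\in\mathrm{Optic}(A)((X,S),(Y,R))$ and objects $Z,W$ of $\mathcal C$, $\ \mathrm{st}_{(Z,W)}[P,a,b]=\big[P,\ A(\mathrm{id},\alpha_{P,Y,Z})(\mathrm{st}_Z(a)),\ A(\alpha_{P,R,W}^{-1},\mathrm{id})(\mathrm{st}_W(b))\big]$. -/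

import Mathlib

open CategoryTheory MonoidalCategory BraidedCategory Opposite Limits

universe w v u v₂ u₂

/-! ### The symmetric monoidal category `C × Cᵒᵖ`

The monoidal structures on products and on opposites are Mathlib's; the symmetries are the
componentwise ones. -/

/-- The componentwise symmetry on a product of symmetric monoidal categories. -/
instance prodSymmetricCategory (C : Type u) [Category.{v} C] [MonoidalCategory C]
    [SymmetricCategory C] (D : Type u₂) [Category.{v₂} D] [MonoidalCategory D]
    [SymmetricCategory D] : SymmetricCategory (C × D) where
  braiding X Y := Iso.prod (β_ X.1 Y.1) (β_ X.2 Y.2)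
  braiding_naturality_right X Y Z f := by ext <;> simp
  braiding_naturality_left f Z := by ext <;> simp
  hexagon_forward X Y Z := by ext <;> simp
  hexagon_reverse X Y Z := by ext <;> simp
  symmetry X Y := by ext <;> simp

/-- The symmetry on the opposite of a symmetric monoidal category. -/
instance opSymmetricCategory (C : Type u) [Category.{v} C] [MonoidalCategory C]
    [SymmetricCategory C] : SymmetricCategory Cᵒᵖ where
  braiding X Y := (β_ (unop Y) (unop X)).op
  braiding_naturality_right X Y Z f := Quiver.Hom.unop_inj (by simp)
  braiding_naturality_left f Z := Quiver.Hom.unop_inj (by simp)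
  hexagon_forward X Y Z := Quiver.Hom.unop_inj (by simp)
  hexagon_reverse X Y Z := Quiver.Hom.unop_inj (by simp)
  symmetry X Y := Quiver.Hom.unop_inj (by simp)

namespace ProfArrow

/-- Endo-profunctors `C ⇸ C`, i.e. functors `Cᵒᵖ × C ⥤ Set`. -/
abbrev EndoProf (C : Type u) [Category.{v} C] := Cᵒᵖ × C ⥤ Type w

section Profunctor

variable {C : Type u} [Category.{v} C]

/-- The set `F(X, Y)`. -/
abbrev EndoProf.El (F : EndoProf.{w} C) (X Y : C) : Type w := F.obj (op X, Y)

/-- The action `F(f, g) : F(X, Y) → F(X', Y')` of `f : X' ⟶ X` and `g : Y ⟶ Y'`. -/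
def EndoProf.dimap (F : EndoProf.{w} C) {X X' Y Y' : C} (f : X' ⟶ X) (g : Y ⟶ Y')
    (a : F.El X Y) : F.El X' Y' :=
  (ConcreteCategory.hom (F.map (Prod.mkHom f.op g : (op X, Y) ⟶ (op X', Y')))) a

theorem EndoProf.dimap_id (F : EndoProf.{w} C) {X Y : C} (a : F.El X Y) :
    F.dimap (𝟙 X) (𝟙 Y) a = a :=
  congrArg (fun h => (ConcreteCategory.hom h) a) (F.map_id (op X, Y))

theorem EndoProf.dimap_dimap (F : EndoProf.{w} C) {X X' X'' Y Y' Y'' : C} (f : X' ⟶ X)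
    (f' : X'' ⟶ X') (g : Y ⟶ Y') (g' : Y' ⟶ Y'') (a : F.El X Y) :
    F.dimap f' g' (F.dimap f g a) = F.dimap (f' ≫ f) (g ≫ g') a :=
  (congrArg (fun h => (ConcreteCategory.hom h) a)
    (F.map_comp (Prod.mkHom f.op g : (op X, Y) ⟶ (op X', Y'))
      (Prod.mkHom f'.op g' : (op X', Y') ⟶ (op X'', Y'')))).symm

end Profunctor

section Strength

variable {C : Type u} [Category.{v} C] [MonoidalCategory C]

/-- A (right) strength for an endo-profunctor on a monoidal category: a family of maps
`F(X, Y) → F(X ⊗ Z, Y ⊗ Z)`, natural in `X`, `Y`, dinatural in `Z`, and compatible with the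
associator and the right unitor. -/
structure Strength (F : EndoProf.{w} C) where
  st {X Y : C} (Z : C) : F.El X Y → F.El (X ⊗ Z) (Y ⊗ Z)
  st_natural {X X' Y Y' : C} (Z : C) (f : X' ⟶ X) (g : Y ⟶ Y') (a : F.El X Y) :
    st Z (F.dimap f g a) = F.dimap (f ▷ Z) (g ▷ Z) (st Z a)
  st_dinatural {X Y Z Z' : C} (h : Z ⟶ Z') (a : F.El X Y) :
    F.dimap (X ◁ h) (𝟙 (Y ⊗ Z')) (st Z' a) = F.dimap (𝟙 (X ⊗ Z)) (Y ◁ h) (st Z a)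
  st_assoc {X Y : C} (Z Z' : C) (a : F.El X Y) :
    F.dimap (α_ X Z Z').hom (α_ Y Z Z').inv (st (Z ⊗ Z') a) = st Z' (st Z a)
  st_unit {X Y : C} (a : F.El X Y) :
    st (𝟙_ C) a = F.dimap (ρ_ X).hom (ρ_ Y).inv a

/-- An arrow structure on an endo-profunctor `F`: a strength on `F` and a monoid structure on the
resulting strong profunctor, with respect to composition of profunctors
`(F • F)(X, Z) = ∫^Y F(X, Y) × F(Y, Z)` and its unit `Hom`.

Natural transformations `F • F ⟶ F` are given, through the universal property of the coend, by
families `F(X, Y) × F(Y, Z) → F(X, Z)` that are natural in `X`, `Z` and dinatural in `Y`.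
The strength of `Hom` is `f ↦ f ▷ Z`, that of `F • F` is `(a, b) ↦ (st a, st b)`. -/
structure ArrowStr (F : EndoProf.{w} C) extends Strength F where
  pure {X Y : C} : (X ⟶ Y) → F.El X Y
  pure_natural {X X' Y Y' : C} (f : X' ⟶ X) (h : X ⟶ Y) (g : Y ⟶ Y') :
    pure (f ≫ h ≫ g) = F.dimap f g (pure h)
  comp {X Y Z : C} : F.El X Y → F.El Y Z → F.El X Z
  comp_natural {X X' Y Z Z' : C} (f : X' ⟶ X) (g : Z ⟶ Z') (a : F.El X Y) (b : F.El Y Z) :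
    comp (F.dimap f (𝟙 Y) a) (F.dimap (𝟙 Y) g b) = F.dimap f g (comp a b)
  comp_dinatural {X Y Y' Z : C} (h : Y ⟶ Y') (a : F.El X Y) (b : F.El Y' Z) :
    comp (F.dimap (𝟙 X) h a) b = comp a (F.dimap h (𝟙 Z) b)
  /-- the unit is a strong natural transformation -/
  st_pure {X Y : C} (Z : C) (f : X ⟶ Y) : st Z (pure f) = pure (f ▷ Z)
  /-- the multiplication is a strong natural transformation -/
  st_comp {X Y Z : C} (W : C) (a : F.El X Y) (b : F.El Y Z) :
    st W (comp a b) = comp (st W a) (st W b)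
  /-- left unit law; `(f, a) ↦ F(f, 𝟙) a` is the left unitor `Hom • F ≅ F` -/
  pure_comp {X Y Z : C} (f : X ⟶ Y) (a : F.El Y Z) : comp (pure f) a = F.dimap f (𝟙 Z) a
  /-- right unit law; `(a, f) ↦ F(𝟙, f) a` is the right unitor `F • Hom ≅ F` -/
  comp_pure {X Y Z : C} (a : F.El X Y) (f : Y ⟶ Z) : comp a (pure f) = F.dimap (𝟙 X) f a
  comp_assoc {X Y Z W : C} (a : F.El X Y) (b : F.El Y Z) (c : F.El Z W) :
    comp (comp a b) c = comp a (comp b c)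

end Strength

section Commutative

variable {C : Type u} [Category.{v} C] [MonoidalCategory C] [SymmetricCategory C]

/-- The left strength `F(X, Y) → F(Z ⊗ X, Z ⊗ Y)` induced by a right strength. -/
def Strength.stL {F : EndoProf.{w} C} (S : Strength F) {X Y : C} (Z : C) (a : F.El X Y) :
    F.El (Z ⊗ X) (Z ⊗ Y) :=
  F.dimap (β_ Z X).hom (β_ Y Z).hom (S.st Z a)

/-- An arrow is commutative if the two ways of forming a parallel composite
`A(X, Y) × A(X', Y') → A(X ⊗ X', Y ⊗ Y')` agree. -/
def ArrowStr.IsCommutative {F : EndoProf.{w} C} (A : ArrowStr F) : Prop :=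
  ∀ ⦃X Y X' Y' : C⦄ (a : F.El X Y) (a' : F.El X' Y'),
    A.comp (A.st X' a) (A.stL Y a') = A.comp (A.stL X a') (A.st Y' a)

end Commutative

section Optic

variable {C : Type u} [Category.{v} C] [MonoidalCategory C]

/-- The bifunctor `(P, P') ↦ A(X, P' ⊗ Y) × A(P ⊗ R, S)`, contravariant in `P` and covariant
in `P'`. -/
def opticIntegrand (A : EndoProf.{max w u} C) (X S Y R : C) :
    Cᵒᵖ ⥤ C ⥤ Type (max w u) where
  obj P :=
    { obj := fun P' => A.El X (P' ⊗ Y) × A.El (P.unop ⊗ R) S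
      map := fun f => ↾fun x => (A.dimap (𝟙 X) (f ▷ Y) x.1, x.2)
      map_id := fun P' => by ext x <;> simp [EndoProf.dimap_id]
      map_comp := fun f g => by ext x <;> simp [EndoProf.dimap_dimap] }
  map g := { app := fun P' => ↾fun x => (x.1, A.dimap (g.unop ▷ R) (𝟙 S) x.2) }
  map_id P := by ext P' x <;> simp [EndoProf.dimap_id]
  map_comp f g := by ext P' x <;> simp [EndoProf.dimap_dimap]

/-- The action of `f : X' ⟶ X`, `s : S ⟶ S'`, `g : Y ⟶ Y'`, `r : R' ⟶ R` on the integrand: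
`(a, b) ↦ (A(f, P' ◁ g) a, A(P ◁ r, s) b)`. -/
def opticIntegrandMap (A : EndoProf.{max w u} C) {X X' S S' Y Y' R R' : C} (f : X' ⟶ X)
    (s : S ⟶ S') (g : Y ⟶ Y') (r : R' ⟶ R) :
    opticIntegrand A X S Y R ⟶ opticIntegrand A X' S' Y' R' where
  app P :=
    { app := fun P' => ↾fun x => (A.dimap f (P' ◁ g) x.1, A.dimap (P.unop ◁ r) s x.2)
      naturality := fun P' Q' h => by
        ext x
        have h₁ : A.dimap f (Q' ◁ g) (A.dimap (𝟙 X) (h ▷ Y) x.1) =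
            A.dimap (𝟙 X') (h ▷ Y') (A.dimap f (P' ◁ g) x.1) := by
          simp [EndoProf.dimap_dimap, whisker_exchange]
        exact Prod.ext h₁ rfl }
  naturality P Q h := by
    ext P' x
    have h₂ : A.dimap (Q.unop ◁ r) s (A.dimap (h.unop ▷ R) (𝟙 S) x.2) =
        A.dimap (h.unop ▷ R') (𝟙 S') (A.dimap (P.unop ◁ r) s x.2) := by
      simp [EndoProf.dimap_dimap, whisker_exchange]
    exact Prod.ext rfl h₂

theorem opticIntegrandMap_id (A : EndoProf.{max w u} C) (X S Y R : C) :
    opticIntegrandMap A (𝟙 X) (𝟙 S) (𝟙 Y) (𝟙 R) = 𝟙 _ := by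
  ext P P' x
  have h₁ : A.dimap (𝟙 X) (P' ◁ 𝟙 Y) x.1 = x.1 := by simp [EndoProf.dimap_id]
  have h₂ : A.dimap (P.unop ◁ 𝟙 R) (𝟙 S) x.2 = x.2 := by simp [EndoProf.dimap_id]
  exact Prod.ext h₁ h₂

theorem opticIntegrandMap_comp (A : EndoProf.{max w u} C)
    {X X' X'' S S' S'' Y Y' Y'' R R' R'' : C} (f : X' ⟶ X) (f' : X'' ⟶ X') (s : S ⟶ S')
    (s' : S' ⟶ S'') (g : Y ⟶ Y') (g' : Y' ⟶ Y'') (r : R' ⟶ R) (r' : R'' ⟶ R') :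
    opticIntegrandMap A (f' ≫ f) (s ≫ s') (g ≫ g') (r' ≫ r) =
      opticIntegrandMap A f s g r ≫ opticIntegrandMap A f' s' g' r' := by
  ext P P' x
  have h₁ : A.dimap (f' ≫ f) (P' ◁ (g ≫ g')) x.1 =
      A.dimap f' (P' ◁ g') (A.dimap f (P' ◁ g) x.1) := by
    simp [EndoProf.dimap_dimap]
  have h₂ : A.dimap (P.unop ◁ (r' ≫ r)) (s ≫ s') x.2 =
      A.dimap (P.unop ◁ r') s' (A.dimap (P.unop ◁ r) s x.2) := by
    simp [EndoProf.dimap_dimap]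
  exact Prod.ext h₁ h₂

/-- The optic profunctor on `C × Cᵒᵖ`,
`Optic(A)((X, S), (Y, R)) = ∫^P A(X, P ⊗ Y) × A(P ⊗ R, S)`. -/
def Optic (A : EndoProf.{max w u} C) : EndoProf.{max w u} (C × Cᵒᵖ) where
  obj U := chosenCoend
    (opticIntegrand A U.1.unop.1 U.1.unop.2.unop U.2.1 U.2.2.unop)
  map φ := chosenCoend.map
    (opticIntegrandMap A φ.1.unop.1 φ.1.unop.2.unop φ.2.1 φ.2.2.unop)
  map_id U := by
    rw [← chosenCoend.map_id, ← opticIntegrandMap_id]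
    rfl
  map_comp φ ψ := by
    rw [chosenCoend.map_comp, ← opticIntegrandMap_comp]
    rfl

/-- The element of `Optic(A)((X, S), (Y, R))` represented by `a ∈ A(X, P ⊗ Y)` and
`b ∈ A(P ⊗ R, S)`. -/
def Optic.mk (A : EndoProf.{max w u} C) {X S Y R : C} (P : C) (a : A.El X (P ⊗ Y))
    (b : A.El (P ⊗ R) S) : (Optic A).El (X, op S) (Y, op R) :=
  (chosenCoend.ι (opticIntegrand A X S Y R) P) (a, b)

end Optic

end ProfArrow

/-!
A commutative arrow `𝒜` on `C` is the same thing as a symmetric monoidal category `ArrowCat 𝒜` with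
the objects of `C`, together with an identity-on-objects strict symmetric monoidal functor from `C`.
Its morphisms `X ⟶ Y` are the elements of `A(X, Y)`, the functor is `pure`, and whiskering on the
right and on the left are the strength `st` and the induced strength `stL`. Commutativity of the
arrow is the interchange law `ArrowCat.exchange`; naturality of the associator and the unitors
comes from the compatibility of the strength with them, transported along the symmetry for the
variables on which the left strength acts.

In `ArrowCat 𝒜` an element of `Optic(A)((X, S), (Y, R))` is represented by a residual `P` and
morphisms `X ⟶ P ⊗ Y` and `P ⊗ R ⟶ S`, up to sliding morphisms of `C` along the residual
(`opticMk_slide`). Each law of the arrow of optics then becomes an identity between morphisms of a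
symmetric monoidal category. The laws of the strength, naturality, and compatibility of the strength
with unit and composition hold for representatives with the same residual. The unit laws,
associativity and commutativity need one slide, along a unitor, an associator and a symmetry of `C`
respectively. These slides are available because the structural isomorphisms of `ArrowCat 𝒜` are
images of those of `C`. Commutativity of optics is the coherence computation
`forward_interchange`, with its dual `backward_interchange`.
-/

namespace ProfArrow

/-! ### Elementary consequences of the arrow axioms -/

section ArrowLemmas

variable {C : Type u} [Category.{v} C] [MonoidalCategory C] {A : EndoProf.{w} C}

theorem ArrowStr.dimap_eq_comp (𝒜 : ArrowStr A) {X X' Y Y' : C} (f : X' ⟶ X) (g : Y ⟶ Y')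
    (a : A.El X Y) : A.dimap f g a = 𝒜.comp (𝒜.pure f) (𝒜.comp a (𝒜.pure g)) := by
  rw [𝒜.pure_comp, 𝒜.comp_pure, EndoProf.dimap_dimap, Category.comp_id, Category.comp_id]

theorem ArrowStr.pure_comp_pure (𝒜 : ArrowStr A) {X Y Z : C} (f : X ⟶ Y) (g : Y ⟶ Z) :
    𝒜.comp (𝒜.pure f) (𝒜.pure g) = 𝒜.pure (f ≫ g) := by
  rw [𝒜.pure_comp, ← 𝒜.pure_natural, Category.comp_id]

end ArrowLemmas

/-! ### The symmetric monoidal category of a commutative arrow -/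

section KleisliCategory

variable {C : Type u} [Category.{v} C] [MonoidalCategory C] [SymmetricCategory C]
  {A : EndoProf.{w} C}

/-- The category of a commutative arrow `𝒜`: its objects are those of `C`, and a morphism
`X ⟶ Y` is an element of `A(X, Y)`. The proof of commutativity is a parameter because the tensor
product is functorial only in its presence. -/
structure ArrowCat (𝒜 : ArrowStr A) (h𝒜 : 𝒜.IsCommutative) : Type u where
  /-- the underlying object of `C` -/
  as : C

namespace ArrowCat

variable {𝒜 : ArrowStr A} {h𝒜 : 𝒜.IsCommutative}

instance : Category.{w} (ArrowCat 𝒜 h𝒜) where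
  Hom X Y := A.El X.as Y.as
  id X := 𝒜.pure (𝟙 X.as)
  comp a b := 𝒜.comp a b
  id_comp _ := (𝒜.pure_comp _ _).trans (A.dimap_id _)
  comp_id _ := (𝒜.comp_pure _ _).trans (A.dimap_id _)
  assoc a b c := 𝒜.comp_assoc a b c

/-- The identity-on-objects functor `C ⥤ ArrowCat 𝒜` on morphisms. It is spelled in terms of
objects of `ArrowCat 𝒜`, so that its values compose without transport. -/
def lift {X Y : ArrowCat 𝒜 h𝒜} (f : X.as ⟶ Y.as) : X ⟶ Y := 𝒜.pure f

@[simp]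
theorem lift_id (X : ArrowCat 𝒜 h𝒜) : lift (𝟙 X.as) = 𝟙 X := rfl

theorem lift_comp_lift {X Y Z : ArrowCat 𝒜 h𝒜} (f : X.as ⟶ Y.as) (g : Y.as ⟶ Z.as) :
    lift f ≫ lift g = lift (f ≫ g) :=
  𝒜.pure_comp_pure f g

/-- In `ArrowCat 𝒜`, the profunctor action is pre- and postcomposition with morphisms of `C`. -/
theorem dimap_eq {X X' Y Y' : ArrowCat 𝒜 h𝒜} (f : X'.as ⟶ X.as) (g : Y.as ⟶ Y'.as) (a : X ⟶ Y) :
    A.dimap f g a = (lift f ≫ a ≫ lift g : X' ⟶ Y') :=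
  𝒜.dimap_eq_comp f g a

/-- An isomorphism of `C`, regarded as an isomorphism of `ArrowCat 𝒜`. -/
def liftIso {X Y : ArrowCat 𝒜 h𝒜} (e : X.as ≅ Y.as) : X ≅ Y where
  hom := lift e.hom
  inv := lift e.inv
  hom_inv_id := by rw [lift_comp_lift, e.hom_inv_id, lift_id]
  inv_hom_id := by rw [lift_comp_lift, e.inv_hom_id, lift_id]

/-- The whiskerings are the two strengths, and the structural isomorphisms are those of `C`. -/
instance : MonoidalCategoryStruct (ArrowCat 𝒜 h𝒜) where
  tensorObj X Y := ⟨X.as ⊗ Y.as⟩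
  whiskerLeft X _ _ a := 𝒜.stL X.as a
  whiskerRight a X := 𝒜.st X.as a
  tensorUnit := ⟨𝟙_ C⟩
  associator X Y Z := liftIso (α_ X.as Y.as Z.as)
  leftUnitor X := liftIso (λ_ X.as)
  rightUnitor X := liftIso (ρ_ X.as)

theorem tensor_as (X Y : ArrowCat 𝒜 h𝒜) : (X ⊗ Y).as = X.as ⊗ Y.as := rfl

/-- The symmetry of `C`, regarded as an isomorphism of `ArrowCat 𝒜`. -/
def swap (X Y : ArrowCat 𝒜 h𝒜) : X ⊗ Y ≅ Y ⊗ X := liftIso (β_ X.as Y.as)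

theorem whiskerLeft_eq (X : ArrowCat 𝒜 h𝒜) {Y Z : ArrowCat 𝒜 h𝒜} (a : Y ⟶ Z) :
    X ◁ a = (swap X Y).hom ≫ a ▷ X ≫ (swap Z X).hom :=
  𝒜.dimap_eq_comp _ _ _

theorem comp_whiskerRight' {X Y Z : ArrowCat 𝒜 h𝒜} (a : X ⟶ Y) (b : Y ⟶ Z)
    (W : ArrowCat 𝒜 h𝒜) : (a ≫ b) ▷ W = a ▷ W ≫ b ▷ W :=
  𝒜.st_comp _ _ _

theorem lift_whiskerRight {X Y : ArrowCat 𝒜 h𝒜} (f : X.as ⟶ Y.as) (Z : ArrowCat 𝒜 h𝒜) :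
    lift f ▷ Z = (lift (f ▷ Z.as) : X ⊗ Z ⟶ Y ⊗ Z) :=
  𝒜.st_pure _ _

@[simp]
theorem swap_swap (X Y : ArrowCat 𝒜 h𝒜) : (swap X Y).hom ≫ (swap Y X).hom = 𝟙 _ :=
  (lift_comp_lift _ _).trans (congrArg lift (SymmetricCategory.symmetry X.as Y.as))

theorem comp_whiskerLeft' (W : ArrowCat 𝒜 h𝒜) {X Y Z : ArrowCat 𝒜 h𝒜} (a : X ⟶ Y) (b : Y ⟶ Z) :
    W ◁ (a ≫ b) = W ◁ a ≫ W ◁ b := by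
  simp [whiskerLeft_eq, comp_whiskerRight', reassoc_of% swap_swap]

theorem whiskerLeft_lift {X Y : ArrowCat 𝒜 h𝒜} (f : X.as ⟶ Y.as) (Z : ArrowCat 𝒜 h𝒜) :
    Z ◁ lift f = (lift (Z.as ◁ f) : Z ⊗ X ⟶ Z ⊗ Y) := by
  rw [whiskerLeft_eq, lift_whiskerRight]
  refine (congrArg _ (lift_comp_lift _ _)).trans ((lift_comp_lift _ _).trans ?_)
  refine congrArg lift ?_
  simp

/-- Commutativity of the arrow is the interchange law. -/
theorem exchange {X Y X' Y' : ArrowCat 𝒜 h𝒜} (a : X ⟶ Y) (a' : X' ⟶ Y') :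
    a ▷ X' ≫ Y ◁ a' = X ◁ a' ≫ a ▷ Y' :=
  h𝒜 a a'

theorem whiskerRight_tensor' {X Y : ArrowCat 𝒜 h𝒜} (a : X ⟶ Y) (Z Z' : ArrowCat 𝒜 h𝒜) :
    a ▷ (Z ⊗ Z') ≫ (α_ Y Z Z').inv = (α_ X Z Z').inv ≫ a ▷ Z ▷ Z' := by
  rw [Iso.eq_inv_comp]
  exact (𝒜.dimap_eq_comp _ _ _).symm.trans (𝒜.st_assoc Z.as Z'.as a)

theorem whiskerRight_unit' {X Y : ArrowCat 𝒜 h𝒜} (a : X ⟶ Y) :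
    a ▷ 𝟙_ _ ≫ (ρ_ Y).hom = (ρ_ X).hom ≫ a := by
  rw [← Iso.eq_comp_inv, Category.assoc]
  exact (𝒜.st_unit a).trans (𝒜.dimap_eq_comp _ _ _)

theorem whiskerLeft_swap (X : ArrowCat 𝒜 h𝒜) {Y Z : ArrowCat 𝒜 h𝒜} (a : Y ⟶ Z) :
    X ◁ a ≫ (swap X Z).hom = (swap X Y).hom ≫ a ▷ X := by
  simp [whiskerLeft_eq]

theorem whiskerRight_swap {Y Z : ArrowCat 𝒜 h𝒜} (a : Y ⟶ Z) (X : ArrowCat 𝒜 h𝒜) :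
    a ▷ X ≫ (swap Z X).hom = (swap Y X).hom ≫ X ◁ a := by
  simp [whiskerLeft_eq, reassoc_of% swap_swap]

theorem whiskerRight_assoc_hom {X Y : ArrowCat 𝒜 h𝒜} (a : X ⟶ Y) (Z Z' : ArrowCat 𝒜 h𝒜) :
    a ▷ Z ▷ Z' ≫ (α_ Y Z Z').hom = (α_ X Z Z').hom ≫ a ▷ (Z ⊗ Z') := by
  rw [← Iso.inv_comp_eq, ← Category.assoc, ← whiskerRight_tensor', Category.assoc,
    Iso.inv_hom_id, Category.comp_id]

theorem associator_hom_eq (X Y Z : ArrowCat 𝒜 h𝒜) :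
    (α_ X Y Z).hom = lift (α_ X.as Y.as Z.as).hom := rfl

theorem associator_inv_eq (X Y Z : ArrowCat 𝒜 h𝒜) :
    (α_ X Y Z).inv = lift (α_ X.as Y.as Z.as).inv := rfl

theorem swap_hom_eq (X Y : ArrowCat 𝒜 h𝒜) : (swap X Y).hom = lift (β_ X.as Y.as).hom := rfl

theorem swap_hexagon (X Y Z : ArrowCat 𝒜 h𝒜) :
    (α_ X Y Z).hom ≫ (swap X (Y ⊗ Z)).hom ≫ (α_ Y Z X).hom =
      (swap X Y).hom ▷ Z ≫ (α_ Y X Z).hom ≫ Y ◁ (swap X Z).hom := by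
  simp only [associator_hom_eq, swap_hom_eq, lift_whiskerRight, whiskerLeft_lift]
  refine (congrArg _ (lift_comp_lift _ _)).trans ((lift_comp_lift _ _).trans ?_)
  refine .trans ?_ (.symm <|
    (congrArg _ (lift_comp_lift _ _)).trans ((lift_comp_lift _ _)))
  exact congrArg lift (BraidedCategory.hexagon_forward X.as Y.as Z.as)

/-- The hexagon for `X ⊗ Y` and `Z`, solved for the symmetry. Its left side passes only through
symmetries and associators for which naturality in `Z` is already known, and so yields the
naturality of the associator in its last variable. -/
theorem swap_tensor_left (X Y Z : ArrowCat 𝒜 h𝒜) :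
    (α_ X Y Z).hom ≫ X ◁ (swap Y Z).hom ≫ (swap X (Z ⊗ Y)).hom ≫ (α_ Z Y X).hom ≫
      Z ◁ (swap Y X).hom = (swap (X ⊗ Y) Z).hom := by
  simp only [associator_hom_eq, swap_hom_eq, whiskerLeft_lift]
  refine (congrArg (_ ≫ _ ≫ _ ≫ ·) (lift_comp_lift _ _)).trans ?_
  refine (congrArg (_ ≫ _ ≫ ·) (lift_comp_lift _ _)).trans ?_
  refine (congrArg (_ ≫ ·) (lift_comp_lift _ _)).trans ?_
  refine (lift_comp_lift _ _).trans (congrArg lift ?_)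
  dsimp only [tensor_as]
  rw [BraidedCategory.braiding_tensor_left_hom, braiding_tensor_right_hom]
  simp [← MonoidalCategory.whiskerLeft_comp]

theorem associator_naturality_right' (X Y : ArrowCat 𝒜 h𝒜) {Z Z' : ArrowCat 𝒜 h𝒜} (a : Z ⟶ Z') :
    (X ⊗ Y) ◁ a ≫ (α_ X Y Z').hom = (α_ X Y Z).hom ≫ X ◁ Y ◁ a := by
  have e : X ◁ Y ◁ a ≫ X ◁ (swap Y Z').hom ≫ (swap X (Z' ⊗ Y)).hom ≫ (α_ Z' Y X).hom ≫
      Z' ◁ (swap Y X).hom = X ◁ (swap Y Z).hom ≫ (swap X (Z ⊗ Y)).hom ≫ (α_ Z Y X).hom ≫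
      Z ◁ (swap Y X).hom ≫ a ▷ (X ⊗ Y) := by
    rw [← reassoc_of% comp_whiskerLeft', whiskerLeft_swap, reassoc_of% comp_whiskerLeft',
      reassoc_of% whiskerLeft_swap, reassoc_of% whiskerRight_assoc_hom, exchange]
  -- By `swap_tensor_left`, this composite is `(α_ X Y Z').inv ≫ (swap (X ⊗ Y) Z').hom`.
  have : IsIso (X ◁ (swap Y Z').hom ≫ (swap X (Z' ⊗ Y)).hom ≫ (α_ Z' Y X).hom ≫
      Z' ◁ (swap Y X).hom) := by
    rw [← (Iso.inv_comp_eq _).2 (swap_tensor_left X Y Z').symm]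
    infer_instance
  rw [← cancel_mono (X ◁ (swap Y Z').hom ≫ (swap X (Z' ⊗ Y)).hom ≫ (α_ Z' Y X).hom ≫
      Z' ◁ (swap Y X).hom), Category.assoc, swap_tensor_left, whiskerLeft_swap,
      ← swap_tensor_left X Y Z]
  simp only [Category.assoc, e]

/-- After composing with the symmetry that moves `X` to the last place, both sides are given by
right whiskerings, and the hexagon identity applies. -/
theorem associator_naturality_middle' (X : ArrowCat 𝒜 h𝒜) {Y Y' : ArrowCat 𝒜 h𝒜} (a : Y ⟶ Y')
    (Z : ArrowCat 𝒜 h𝒜) :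
    (X ◁ a) ▷ Z ≫ (α_ X Y' Z).hom = (α_ X Y Z).hom ≫ X ◁ (a ▷ Z) := by
  rw [← cancel_mono (swap X (Y' ⊗ Z)).hom, ← cancel_mono (α_ Y' Z X).hom]
  simp only [Category.assoc]
  rw [swap_hexagon, reassoc_of% whiskerLeft_swap, whiskerRight_assoc_hom,
    ← reassoc_of% comp_whiskerRight', whiskerLeft_swap, reassoc_of% comp_whiskerRight',
    reassoc_of% whiskerRight_assoc_hom, exchange, ← reassoc_of% swap_hexagon]

theorem whiskerLeft_unit' {X Y : ArrowCat 𝒜 h𝒜} (a : X ⟶ Y) :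
    𝟙_ _ ◁ a ≫ (λ_ Y).hom = (λ_ X).hom ≫ a := by
  have e (Z : ArrowCat 𝒜 h𝒜) : (λ_ Z).hom = (swap (𝟙_ _) Z).hom ≫ (ρ_ Z).hom :=
    ((lift_comp_lift _ _).trans (congrArg lift (braiding_rightUnitor Z.as))).symm
  rw [e, e, reassoc_of% whiskerLeft_swap, whiskerRight_unit', Category.assoc]

theorem id_whiskerRight' (X Y : ArrowCat 𝒜 h𝒜) : 𝟙 X ▷ Y = 𝟙 (X ⊗ Y) :=
  (lift_whiskerRight _ _).trans (congrArg lift (id_whiskerRight X.as Y.as))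

theorem whiskerLeft_id' (X Y : ArrowCat 𝒜 h𝒜) : X ◁ 𝟙 Y = 𝟙 (X ⊗ Y) :=
  (whiskerLeft_lift _ _).trans (congrArg lift (whiskerLeft_id X.as Y.as))

theorem tensorHom_def'' {X X' Y Y' : ArrowCat 𝒜 h𝒜} (a : X ⟶ X') (b : Y ⟶ Y') :
    a ⊗ₘ b = a ▷ Y ≫ X' ◁ b := rfl

/-- Commutativity of the arrow is what makes the two whiskerings into a tensor product. -/
instance : MonoidalCategory (ArrowCat 𝒜 h𝒜) where
  id_tensorHom_id X Y := by
    rw [tensorHom_def'', id_whiskerRight', whiskerLeft_id', Category.comp_id]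
  tensorHom_comp_tensorHom a a' b b' := by
    simp only [tensorHom_def'', comp_whiskerRight', comp_whiskerLeft', Category.assoc]
    rw [← reassoc_of% exchange b a']
  whiskerLeft_id := whiskerLeft_id'
  id_whiskerRight := id_whiskerRight'
  associator_naturality a b c := by
    simp only [tensorHom_def'', comp_whiskerRight', comp_whiskerLeft', Category.assoc]
    rw [associator_naturality_right', reassoc_of% associator_naturality_middle',
      reassoc_of% whiskerRight_assoc_hom]
  leftUnitor_naturality := whiskerLeft_unit'
  rightUnitor_naturality := whiskerRight_unit'
  pentagon W X Y Z := by
    simp only [associator_hom_eq, lift_whiskerRight, whiskerLeft_lift]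
    refine (congrArg _ (lift_comp_lift _ _)).trans ((lift_comp_lift _ _).trans ?_)
    exact (congrArg lift (MonoidalCategory.pentagon W.as X.as Y.as Z.as)).trans
      (lift_comp_lift _ _).symm
  triangle X Y :=
    (congrArg _ (whiskerLeft_lift _ _)).trans <| (lift_comp_lift _ _).trans <|
      (congrArg lift (MonoidalCategory.triangle X.as Y.as)).trans (lift_whiskerRight _ _).symm

instance : SymmetricCategory (ArrowCat 𝒜 h𝒜) where
  braiding := swap
  braiding_naturality_right X _ _ a := whiskerLeft_swap X a
  braiding_naturality_left a Z := whiskerRight_swap a Z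
  hexagon_forward := swap_hexagon
  hexagon_reverse X Y Z := by
    simp only [associator_inv_eq, swap_hom_eq, lift_whiskerRight, whiskerLeft_lift]
    refine (congrArg _ (lift_comp_lift _ _)).trans ((lift_comp_lift _ _).trans ?_)
    refine .trans ?_ (.symm <|
      (congrArg _ (lift_comp_lift _ _)).trans ((lift_comp_lift _ _)))
    exact congrArg lift (BraidedCategory.hexagon_reverse X.as Y.as Z.as)
  symmetry := swap_swap

end ArrowCat

end KleisliCategory

/-! ### The interchange of residuals in a symmetric monoidal category -/

section Interchange

variable {M : Type u} [Category.{v} M] [MonoidalCategory M] [SymmetricCategory M]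

/-- Braiding the residuals `P` and `Q` only, after exchanging the middle factors, amounts to braiding
`P ⊗ Y` with `Q ⊗ Y'` entirely and then moving `Y'` back past `P ⊗ Y`. -/
theorem tensorμ_braiding_whiskerRight (P Y Q Y' : M) :
    tensorμ P Y Q Y' ≫ (β_ P Q).hom ▷ (Y ⊗ Y') =
      (β_ (P ⊗ Y) (Q ⊗ Y')).hom ≫ (α_ Q Y' (P ⊗ Y)).hom ≫
        Q ◁ ((β_ Y' (P ⊗ Y)).hom ≫ (α_ P Y Y').hom) ≫ (α_ Q P (Y ⊗ Y')).inv := by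
  rw [BraidedCategory.braiding_tensor_right_hom (P ⊗ Y) Q Y',
    BraidedCategory.braiding_tensor_left_hom P Y Q]
  simp only [tensorμ, Category.assoc, Iso.inv_hom_id_assoc, MonoidalCategory.whiskerLeft_comp]
  rw [← MonoidalCategory.whiskerLeft_comp_assoc Q (β_ (P ⊗ Y) Y').hom, SymmetricCategory.symmetry]
  monoidal

/-- The forward parts of the two parallel composites of a pair of optics agree up to the braiding of
the residuals: both are `a ⊗ a'` followed by a permutation of the four factors. -/
theorem forward_interchange {X X' Y Y' P Q : M} (a : X ⟶ P ⊗ Y) (a' : X' ⟶ Q ⊗ Y') :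
    ((a ▷ X' ≫ (α_ P Y X').hom) ≫ P ◁ ((β_ Y X').hom ≫ (a' ▷ Y ≫ (α_ Q Y' Y).hom) ≫
      Q ◁ (β_ Y' Y).hom) ≫ (α_ P Q (Y ⊗ Y')).inv) ≫ (β_ P Q).hom ▷ (Y ⊗ Y') =
    ((β_ X X').hom ≫ (a' ▷ X ≫ (α_ Q Y' X).hom) ≫ Q ◁ (β_ Y' X).hom) ≫
      Q ◁ (a ▷ Y' ≫ (α_ P Y Y').hom) ≫ (α_ Q P (Y ⊗ Y')).inv := by
  have h₁ : (a ▷ X' ≫ (α_ P Y X').hom) ≫ P ◁ ((β_ Y X').hom ≫ (a' ▷ Y ≫ (α_ Q Y' Y).hom) ≫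
      Q ◁ (β_ Y' Y).hom) ≫ (α_ P Q (Y ⊗ Y')).inv =
      a ▷ X' ≫ (P ⊗ Y) ◁ a' ≫ tensorμ P Y Q Y' := by
    rw [Category.assoc (a' ▷ Y), ← BraidedCategory.braiding_naturality_right_assoc,
      BraidedCategory.braiding_tensor_right_hom]
    simp only [Category.assoc, Iso.inv_hom_id_assoc]
    rw [← MonoidalCategory.whiskerLeft_comp Q (β_ Y Y').hom, SymmetricCategory.symmetry]
    simp only [tensorμ]
    monoidal
  have h₂ : ((β_ X X').hom ≫ (a' ▷ X ≫ (α_ Q Y' X).hom) ≫ Q ◁ (β_ Y' X).hom) ≫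
      Q ◁ (a ▷ Y' ≫ (α_ P Y Y').hom) ≫ (α_ Q P (Y ⊗ Y')).inv =
      a ▷ X' ≫ (P ⊗ Y) ◁ a' ≫ (β_ (P ⊗ Y) (Q ⊗ Y')).hom ≫ (α_ Q Y' (P ⊗ Y)).hom ≫
        Q ◁ ((β_ Y' (P ⊗ Y)).hom ≫ (α_ P Y Y').hom) ≫ (α_ Q P (Y ⊗ Y')).inv := by
    rw [BraidedCategory.braiding_naturality_right_assoc,
      BraidedCategory.braiding_naturality_left_assoc, whisker_exchange_assoc,
      associator_naturality_right_assoc, ← MonoidalCategory.whiskerLeft_comp_assoc Q (Y' ◁ a),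
      BraidedCategory.braiding_naturality_right_assoc]
    simp
  rw [h₁, h₂, Category.assoc, Category.assoc, tensorμ_braiding_whiskerRight]

/-- The backward parts of the two parallel composites; this is `forward_interchange` in the opposite
category. -/
theorem backward_interchange {S S' R R' P Q : M} (b : P ⊗ R ⟶ S) (b' : Q ⊗ R' ⟶ S') :
    (β_ P Q).hom ▷ (R ⊗ R') ≫ (α_ Q P (R ⊗ R')).hom ≫ Q ◁ ((α_ P R R').inv ≫ b ▷ R') ≫
        Q ◁ (β_ S R').hom ≫ ((α_ Q R' S).inv ≫ b' ▷ S) ≫ (β_ S' S).hom =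
      (α_ P Q (R ⊗ R')).hom ≫ P ◁ (Q ◁ (β_ R R').hom ≫ ((α_ Q R' R).inv ≫ b' ▷ R) ≫
        (β_ S' R).hom) ≫ (α_ P R S').inv ≫ b ▷ S' := by
  have h := congrArg Quiver.Hom.unop (forward_interchange (M := Mᵒᵖ)
    (X := op S) (X' := op S') (Y := op R) (Y' := op R') (P := op P) (Q := op Q) b.op b'.op)
  have h' : (β_ Q P).hom ▷ (R ⊗ R') ≫ (α_ P Q (R ⊗ R')).hom ≫ P ◁ (Q ◁ (β_ R R').hom ≫
      ((α_ Q R' R).inv ≫ b' ▷ R) ≫ (β_ S' R).hom) ≫ (α_ P R S').inv ≫ b ▷ S' =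
      (α_ Q P (R ⊗ R')).hom ≫ Q ◁ ((α_ P R R').inv ≫ b ▷ R') ≫
        Q ◁ (β_ S R').hom ≫ ((α_ Q R' S).inv ≫ b' ▷ S) ≫ (β_ S' S).hom := by
    simpa [-BraidedCategory.braiding_naturality_left] using h
  rw [← h', ← MonoidalCategory.comp_whiskerRight_assoc, SymmetricCategory.symmetry]
  simp

end Interchange

/-! ### Operations on optics -/

section OpticOperations

variable {C : Type u} [Category.{v} C] [MonoidalCategory C] [SymmetricCategory C]
  {A : EndoProf.{max w u} C} {𝒜 : ArrowStr A} {h𝒜 : 𝒜.IsCommutative}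

/-- The class of a pair of morphisms of `ArrowCat 𝒜` with residual `P`. -/
def opticMk {X S Y R : ArrowCat 𝒜 h𝒜} (P : ArrowCat 𝒜 h𝒜) (a : X ⟶ P ⊗ Y) (b : P ⊗ R ⟶ S) :
    (Optic.{w} A).El (X.as, op S.as) (Y.as, op R.as) :=
  Optic.mk A P.as a b

/-- Sliding along a residual is possible along morphisms of `C` only, not along all those of
`ArrowCat 𝒜`, since the coend is taken over `C`. -/
theorem opticMk_slide {X S Y R P Q : ArrowCat 𝒜 h𝒜} (h : P.as ⟶ Q.as) (a : X ⟶ P ⊗ Y)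
    (b : Q ⊗ R ⟶ S) :
    opticMk Q (a ≫ ArrowCat.lift h ▷ Y) b = opticMk P a (ArrowCat.lift h ▷ R ≫ b) := by
  let x : ((opticIntegrand A X.as S.as Y.as R.as).obj (op Q.as)).obj P.as := (a, b)
  have e := ConcreteCategory.congr_hom (chosenCoend.condition
    (opticIntegrand A X.as S.as Y.as R.as) h) x
  have h₁ : A.dimap (𝟙 X.as) (h ▷ Y.as) a = (a ≫ ArrowCat.lift h ▷ Y : X ⟶ Q ⊗ Y) := by
    rw [ArrowCat.lift_whiskerRight]
    exact (𝒜.comp_pure _ _).symm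
  have h₂ : A.dimap (h ▷ R.as) (𝟙 S.as) b = (ArrowCat.lift h ▷ R ≫ b : P ⊗ R ⟶ S) := by
    rw [ArrowCat.lift_whiskerRight]
    exact (𝒜.pure_comp _ _).symm
  unfold opticMk
  rw [← h₁, ← h₂]
  exact e.symm

theorem opticMk_surjective {X S Y R : ArrowCat 𝒜 h𝒜}
    (x : (Optic.{w} A).El (X.as, op S.as) (Y.as, op R.as)) :
    ∃ (P : ArrowCat 𝒜 h𝒜) (a : X ⟶ P ⊗ Y) (b : P ⊗ R ⟶ S), opticMk P a b = x := by
  obtain ⟨⟨P, a, b⟩, rfl⟩ := Quot.exists_rep x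
  exact ⟨⟨P⟩, a, b, rfl⟩

/-- A map out of the optic profunctor, given on representatives and invariant under sliding. -/
def opticDesc {X S Y R : ArrowCat 𝒜 h𝒜} {T : Type (max w u)}
    (φ : ∀ P : ArrowCat 𝒜 h𝒜, (X ⟶ P ⊗ Y) → (P ⊗ R ⟶ S) → T)
    (hφ : ∀ (P Q : ArrowCat 𝒜 h𝒜) (h : P.as ⟶ Q.as) (a : X ⟶ P ⊗ Y) (b : Q ⊗ R ⟶ S),
      φ Q (a ≫ ArrowCat.lift h ▷ Y) b = φ P a (ArrowCat.lift h ▷ R ≫ b)) :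
    (Optic.{w} A).El (X.as, op S.as) (Y.as, op R.as) → T :=
  ConcreteCategory.hom (chosenCoend.desc (F := opticIntegrand A X.as S.as Y.as R.as)
    (fun P => ↾fun x => φ ⟨P⟩ x.1 x.2) (fun P Q h => by
      ext x
      have h₁ : A.dimap (𝟙 X.as) (h ▷ Y.as) x.1 =
          ((x.1 : X ⟶ ⟨P⟩ ⊗ Y) ≫ ArrowCat.lift h ▷ Y : X ⟶ ⟨Q⟩ ⊗ Y) := by
        rw [ArrowCat.lift_whiskerRight]
        exact (𝒜.comp_pure _ _).symm
      have h₂ : A.dimap (h ▷ R.as) (𝟙 S.as) x.2 =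
          (ArrowCat.lift h ▷ R ≫ (x.2 : ⟨Q⟩ ⊗ R ⟶ S) : ⟨P⟩ ⊗ R ⟶ S) := by
        rw [ArrowCat.lift_whiskerRight]
        exact (𝒜.pure_comp _ _).symm
      exact (congrArg (φ ⟨P⟩ _) h₂).trans ((hφ ⟨P⟩ ⟨Q⟩ h x.1 x.2).symm.trans
        (congrArg (φ ⟨Q⟩ · _) h₁.symm))))

@[simp]
theorem opticDesc_opticMk {X S Y R : ArrowCat 𝒜 h𝒜} {T : Type (max w u)}
    (φ : ∀ P : ArrowCat 𝒜 h𝒜, (X ⟶ P ⊗ Y) → (P ⊗ R ⟶ S) → T) (hφ)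
    (P : ArrowCat 𝒜 h𝒜) (a : X ⟶ P ⊗ Y) (b : P ⊗ R ⟶ S) :
    opticDesc φ hφ (opticMk P a b) = φ P a b := rfl

theorem dimap_opticMk {X S Y R X' S' Y' R' : ArrowCat 𝒜 h𝒜}
    (f : (X'.as, op S'.as) ⟶ (X.as, op S.as)) (g : (Y.as, op R.as) ⟶ (Y'.as, op R'.as))
    (P : ArrowCat 𝒜 h𝒜) (a : X ⟶ P ⊗ Y) (b : P ⊗ R ⟶ S) :
    (Optic.{w} A).dimap f g (opticMk P a b) =
      opticMk P (ArrowCat.lift f.1 ≫ a ≫ P ◁ ArrowCat.lift g.1 : X' ⟶ P ⊗ Y')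
        (P ◁ ArrowCat.lift g.2.unop ≫ b ≫ ArrowCat.lift f.2.unop : P ⊗ R' ⟶ S') := by
  have h₁ : A.dimap f.1 (P.as ◁ g.1) a =
      (ArrowCat.lift f.1 ≫ a ≫ P ◁ ArrowCat.lift g.1 : X' ⟶ P ⊗ Y') := by
    rw [ArrowCat.whiskerLeft_lift]
    exact ArrowCat.dimap_eq _ _ _
  have h₂ : A.dimap (P.as ◁ g.2.unop) f.2.unop b =
      (P ◁ ArrowCat.lift g.2.unop ≫ b ≫ ArrowCat.lift f.2.unop : P ⊗ R' ⟶ S') := by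
    rw [ArrowCat.whiskerLeft_lift]
    exact ArrowCat.dimap_eq _ _ _
  rw [← h₁, ← h₂]
  rfl

/-- The unit of the arrow of optics. -/
def opticPure {X S Y R : ArrowCat 𝒜 h𝒜} (f : (X.as, op S.as) ⟶ (Y.as, op R.as)) :
    (Optic.{w} A).El (X.as, op S.as) (Y.as, op R.as) :=
  opticMk (𝟙_ _) (ArrowCat.lift f.1 ≫ (λ_ Y).inv) ((λ_ R).hom ≫ ArrowCat.lift f.2.unop)

/-- The composition of optics, whose residual is the tensor product of the two residuals. -/
def opticComp {X S Y R Z T : ArrowCat 𝒜 h𝒜}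
    (x : (Optic.{w} A).El (X.as, op S.as) (Y.as, op R.as))
    (y : (Optic.{w} A).El (Y.as, op R.as) (Z.as, op T.as)) :
    (Optic.{w} A).El (X.as, op S.as) (Z.as, op T.as) :=
  opticDesc (X := X) (S := S) (Y := Y) (R := R) (fun P a b =>
    opticDesc (X := Y) (S := R) (Y := Z) (R := T) (fun Q a' b' =>
      opticMk (P ⊗ Q) (a ≫ P ◁ a' ≫ (α_ P Q Z).inv) ((α_ P Q T).hom ≫ P ◁ b' ≫ b))
      (fun Q Q' h a' b' => by
        have e := opticMk_slide (P := P ⊗ Q) (Q := P ⊗ Q') (P.as ◁ h)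
          (a ≫ P ◁ a' ≫ (α_ P Q Z).inv) ((α_ P Q' T).hom ≫ P ◁ b' ≫ b)
        rw [← ArrowCat.whiskerLeft_lift] at e
        simpa using e) y)
    (fun P P' h a b => by
      obtain ⟨Q, a', b', rfl⟩ := opticMk_surjective y
      simp only [opticDesc_opticMk]
      have e := opticMk_slide (P := P ⊗ Q) (Q := P' ⊗ Q) (h ▷ Q.as)
          (a ≫ P ◁ a' ≫ (α_ P Q Z).inv) ((α_ P' Q T).hom ≫ P' ◁ b' ≫ b)
      rw [← ArrowCat.lift_whiskerRight] at e
      have h₁ : (a ≫ P ◁ a' ≫ (α_ P Q Z).inv) ≫ ArrowCat.lift h ▷ Q ▷ Z =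
          (a ≫ ArrowCat.lift h ▷ Y) ≫ P' ◁ a' ≫ (α_ P' Q Z).inv := by
        simp only [Category.assoc]
        rw [← associator_inv_naturality_left, whisker_exchange_assoc]
      have h₂ : ArrowCat.lift h ▷ Q ▷ T ≫ (α_ P' Q T).hom ≫ P' ◁ b' ≫ b =
          (α_ P Q T).hom ≫ P ◁ b' ≫ ArrowCat.lift h ▷ R ≫ b := by
        rw [associator_naturality_left_assoc, whisker_exchange_assoc]
      rwa [h₁, h₂] at e) x

@[simp]
theorem opticComp_opticMk {X S Y R Z T P Q : ArrowCat 𝒜 h𝒜} (a : X ⟶ P ⊗ Y) (b : P ⊗ R ⟶ S)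
    (a' : Y ⟶ Q ⊗ Z) (b' : Q ⊗ T ⟶ R) :
    opticComp (opticMk P a b) (opticMk Q a' b') =
      opticMk (P ⊗ Q) (a ≫ P ◁ a' ≫ (α_ P Q Z).inv) ((α_ P Q T).hom ≫ P ◁ b' ≫ b) := rfl

/-- The strength of the arrow of optics, which leaves the residual unchanged. -/
def opticSt {X S Y R : ArrowCat 𝒜 h𝒜} (Z W : ArrowCat 𝒜 h𝒜)
    (x : (Optic.{w} A).El (X.as, op S.as) (Y.as, op R.as)) :
    (Optic.{w} A).El ((X ⊗ Z).as, op (S ⊗ W).as) ((Y ⊗ Z).as, op (R ⊗ W).as) :=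
  opticDesc (X := X) (S := S) (Y := Y) (R := R) (fun P a b =>
    opticMk P (a ▷ Z ≫ (α_ P Y Z).hom) ((α_ P R W).inv ≫ b ▷ W))
    (fun P Q h a b => by
      have e := opticMk_slide h (a ▷ Z ≫ (α_ P Y Z).hom) ((α_ Q R W).inv ≫ b ▷ W)
      simpa using e) x

@[simp]
theorem opticSt_opticMk {X S Y R P : ArrowCat 𝒜 h𝒜} (Z W : ArrowCat 𝒜 h𝒜) (a : X ⟶ P ⊗ Y)
    (b : P ⊗ R ⟶ S) :
    opticSt Z W (opticMk P a b) =
      opticMk P (a ▷ Z ≫ (α_ P Y Z).hom) ((α_ P R W).inv ≫ b ▷ W) := rfl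

end OpticOperations
/-! ### The laws of the arrow of optics -/

section OpticLaws

variable {C : Type u} [Category.{v} C] [MonoidalCategory C] [SymmetricCategory C]
  {A : EndoProf.{max w u} C} {𝒜 : ArrowStr A} {h𝒜 : 𝒜.IsCommutative}

theorem opticMk_congr {X S Y R P : ArrowCat 𝒜 h𝒜} {a a' : X ⟶ P ⊗ Y} {b b' : P ⊗ R ⟶ S}
    (h₁ : a = a') (h₂ : b = b') : opticMk P a b = opticMk P a' b' := by rw [h₁, h₂]

/-- Two optics are equal as soon as some morphism of `C` between their residuals carries the forward
part of the first to that of the second, and the backward part of the second to that of the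
first. -/
theorem opticMk_eq_of_slide {X S Y R P Q : ArrowCat 𝒜 h𝒜} (h : P.as ⟶ Q.as) {a : X ⟶ P ⊗ Y}
    {b : P ⊗ R ⟶ S} {a' : X ⟶ Q ⊗ Y} {b' : Q ⊗ R ⟶ S} (h₁ : a ≫ ArrowCat.lift h ▷ Y = a')
    (h₂ : b = ArrowCat.lift h ▷ R ≫ b') : opticMk P a b = opticMk Q a' b' := by
  rw [← h₁, h₂, opticMk_slide]

theorem opticSt_natural {X S Y R X' S' Y' R' : ArrowCat 𝒜 h𝒜} (Z W : ArrowCat 𝒜 h𝒜)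
    (f : (X'.as, op S'.as) ⟶ (X.as, op S.as)) (g : (Y.as, op R.as) ⟶ (Y'.as, op R'.as))
    (x : (Optic.{w} A).El (X.as, op S.as) (Y.as, op R.as)) :
    opticSt (X := X') (S := S') (Y := Y') (R := R') Z W ((Optic.{w} A).dimap f g x) =
      (Optic.{w} A).dimap (f ▷ (Z.as, op W.as)) (g ▷ (Z.as, op W.as)) (opticSt Z W x) := by
  obtain ⟨P, a, b, rfl⟩ := opticMk_surjective x
  rw [dimap_opticMk, opticSt_opticMk, opticSt_opticMk]
  refine .trans (opticMk_congr ?_ ?_) (dimap_opticMk (X' := X' ⊗ Z) (S' := S' ⊗ W)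
    (Y' := Y' ⊗ Z) (R' := R' ⊗ W) (f ▷ (Z.as, op W.as)) (g ▷ (Z.as, op W.as)) _ _ _).symm
  -- Morphisms of `C × Cᵒᵖ` act on the two parts of an optic separately: the first component on the
  -- forward part, and the second, read as a morphism of `C`, on the backward part.
  · change _ = ArrowCat.lift (f.1 ▷ Z.as) ≫ _ ≫ P ◁ ArrowCat.lift (g.1 ▷ Z.as)
    rw [← ArrowCat.lift_whiskerRight, ← ArrowCat.lift_whiskerRight]
    simp
  · change _ = P ◁ ArrowCat.lift (g.2.unop ▷ W.as) ≫ _ ≫ ArrowCat.lift (f.2.unop ▷ W.as)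
    rw [← ArrowCat.lift_whiskerRight, ← ArrowCat.lift_whiskerRight]
    simp

theorem opticSt_dinatural {X S Y R Z W Z' W' : ArrowCat 𝒜 h𝒜}
    (h : (Z.as, op W.as) ⟶ (Z'.as, op W'.as))
    (x : (Optic.{w} A).El (X.as, op S.as) (Y.as, op R.as)) :
    (Optic.{w} A).dimap ((X.as, op S.as) ◁ h) (𝟙 ((Y.as, op R.as) ⊗ (Z'.as, op W'.as)))
        (opticSt Z' W' x) =
      (Optic.{w} A).dimap (𝟙 ((X.as, op S.as) ⊗ (Z.as, op W.as))) ((Y.as, op R.as) ◁ h)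
        (opticSt Z W x) := by
  obtain ⟨P, a, b, rfl⟩ := opticMk_surjective x
  rw [opticSt_opticMk, opticSt_opticMk]
  refine .trans (dimap_opticMk (X' := X ⊗ Z) (S' := S ⊗ W) (Y' := Y ⊗ Z') (R' := R ⊗ W')
    _ _ _ _ _) <| .trans (opticMk_congr ?_ ?_) (dimap_opticMk (X' := X ⊗ Z) (S' := S ⊗ W)
    (Y' := Y ⊗ Z') (R' := R ⊗ W') _ _ _ _ _).symm
  · change ArrowCat.lift (X.as ◁ h.1) ≫ _ ≫ P ◁ ArrowCat.lift (𝟙 (Y ⊗ Z').as) =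
      ArrowCat.lift (𝟙 (X ⊗ Z).as) ≫ _ ≫ P ◁ ArrowCat.lift (Y.as ◁ h.1)
    rw [← ArrowCat.whiskerLeft_lift, ← ArrowCat.whiskerLeft_lift]
    simp only [ArrowCat.lift_id]
    simp [whisker_exchange_assoc]
  · change P ◁ ArrowCat.lift (𝟙 (R ⊗ W').as) ≫ _ ≫ ArrowCat.lift (S.as ◁ h.2.unop) =
      P ◁ ArrowCat.lift (R.as ◁ h.2.unop) ≫ _ ≫ ArrowCat.lift (𝟙 (S ⊗ W).as)
    rw [← ArrowCat.whiskerLeft_lift, ← ArrowCat.whiskerLeft_lift]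
    simp only [ArrowCat.lift_id]
    simp [← whisker_exchange]

theorem opticSt_assoc {X S Y R : ArrowCat 𝒜 h𝒜} (Z W Z' W' : ArrowCat 𝒜 h𝒜)
    (x : (Optic.{w} A).El (X.as, op S.as) (Y.as, op R.as)) :
    (Optic.{w} A).dimap (α_ (X.as, op S.as) (Z.as, op W.as) (Z'.as, op W'.as)).hom
        (α_ (Y.as, op R.as) (Z.as, op W.as) (Z'.as, op W'.as)).inv
        (opticSt (Z ⊗ Z') (W ⊗ W') x) =
      opticSt Z' W' (opticSt Z W x) := by
  obtain ⟨P, a, b, rfl⟩ := opticMk_surjective x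
  rw [opticSt_opticMk, opticSt_opticMk, opticSt_opticMk]
  refine .trans (dimap_opticMk (X' := (X ⊗ Z) ⊗ Z') (S' := (S ⊗ W) ⊗ W')
    (Y' := (Y ⊗ Z) ⊗ Z') (R' := (R ⊗ W) ⊗ W') _ _ _ _ _) (opticMk_congr ?_ ?_)
  · change (α_ X Z Z').hom ≫ _ ≫ P ◁ (α_ Y Z Z').inv = _
    simp
  · change P ◁ (α_ R W W').hom ≫ _ ≫ (α_ S W W').inv = _
    simp

theorem opticSt_unit {X S Y R : ArrowCat 𝒜 h𝒜}
    (x : (Optic.{w} A).El (X.as, op S.as) (Y.as, op R.as)) :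
    opticSt (𝟙_ _) (𝟙_ _) x = (Optic.{w} A).dimap (ρ_ (X.as, op S.as)).hom
        (ρ_ (Y.as, op R.as)).inv x := by
  obtain ⟨P, a, b, rfl⟩ := opticMk_surjective x
  rw [opticSt_opticMk]
  refine .trans (opticMk_congr ?_ ?_) (dimap_opticMk (X' := X ⊗ 𝟙_ _) (S' := S ⊗ 𝟙_ _)
    (Y' := Y ⊗ 𝟙_ _) (R' := R ⊗ 𝟙_ _) _ _ _ _ _).symm
  · change _ = (ρ_ X).hom ≫ _ ≫ P ◁ (ρ_ Y).inv
    simp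
  · change _ = P ◁ (ρ_ R).hom ≫ _ ≫ (ρ_ S).inv
    simp

theorem opticPure_natural {X S Y R X' S' Y' R' : ArrowCat 𝒜 h𝒜}
    (f : (X'.as, op S'.as) ⟶ (X.as, op S.as)) (k : (X.as, op S.as) ⟶ (Y.as, op R.as))
    (g : (Y.as, op R.as) ⟶ (Y'.as, op R'.as)) :
    opticPure (h𝒜 := h𝒜) (f ≫ k ≫ g) = (Optic.{w} A).dimap f g (opticPure (h𝒜 := h𝒜) k) := by
  unfold opticPure
  rw [dimap_opticMk]
  refine opticMk_congr ?_ ?_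
  · change ArrowCat.lift (f.1 ≫ k.1 ≫ g.1) ≫ _ = _
    simp only [← ArrowCat.lift_comp_lift]
    simp
  · change _ ≫ ArrowCat.lift ((g.2.unop ≫ k.2.unop) ≫ f.2.unop) = _
    simp only [← ArrowCat.lift_comp_lift]
    simp

theorem opticComp_natural {X S Y R X' S' Z T Z' T' : ArrowCat 𝒜 h𝒜}
    (f : (X'.as, op S'.as) ⟶ (X.as, op S.as)) (g : (Z.as, op T.as) ⟶ (Z'.as, op T'.as))
    (x : (Optic.{w} A).El (X.as, op S.as) (Y.as, op R.as))
    (y : (Optic.{w} A).El (Y.as, op R.as) (Z.as, op T.as)) :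
    opticComp (h𝒜 := h𝒜) ((Optic.{w} A).dimap f (𝟙 _) x) ((Optic.{w} A).dimap (𝟙 _) g y) =
      (Optic.{w} A).dimap f g (opticComp (h𝒜 := h𝒜) x y) := by
  obtain ⟨P, a, b, rfl⟩ := opticMk_surjective (h𝒜 := h𝒜) x
  obtain ⟨Q, a', b', rfl⟩ := opticMk_surjective (h𝒜 := h𝒜) y
  rw [dimap_opticMk, dimap_opticMk, opticComp_opticMk, opticComp_opticMk, dimap_opticMk]
  refine opticMk_congr ?_ ?_
  · simp
  · simp

theorem opticComp_dinatural {X S Y R Y' R' Z T : ArrowCat 𝒜 h𝒜}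
    (h : (Y.as, op R.as) ⟶ (Y'.as, op R'.as))
    (x : (Optic.{w} A).El (X.as, op S.as) (Y.as, op R.as))
    (y : (Optic.{w} A).El (Y'.as, op R'.as) (Z.as, op T.as)) :
    opticComp (h𝒜 := h𝒜) ((Optic.{w} A).dimap (𝟙 _) h x) y =
      opticComp (h𝒜 := h𝒜) x ((Optic.{w} A).dimap h (𝟙 _) y) := by
  obtain ⟨P, a, b, rfl⟩ := opticMk_surjective (h𝒜 := h𝒜) x
  obtain ⟨Q, a', b', rfl⟩ := opticMk_surjective (h𝒜 := h𝒜) y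
  rw [dimap_opticMk, dimap_opticMk, opticComp_opticMk, opticComp_opticMk]
  refine opticMk_congr ?_ ?_
  · simp
  · simp

theorem opticSt_pure {X S Y R : ArrowCat 𝒜 h𝒜} (Z W : ArrowCat 𝒜 h𝒜)
    (f : (X.as, op S.as) ⟶ (Y.as, op R.as)) :
    opticSt Z W (opticPure f) = opticPure (X := X ⊗ Z) (S := S ⊗ W) (Y := Y ⊗ Z) (R := R ⊗ W)
      (f ▷ (Z.as, op W.as)) := by
  refine opticMk_congr ?_ ?_
  · change (ArrowCat.lift f.1 ≫ (λ_ Y).inv) ▷ Z ≫ (α_ (𝟙_ _) Y Z).hom =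
      ArrowCat.lift (f.1 ▷ Z.as) ≫ (λ_ (Y ⊗ Z)).inv
    rw [← ArrowCat.lift_whiskerRight]
    simp
  · change (α_ (𝟙_ _) R W).inv ≫ ((λ_ R).hom ≫ ArrowCat.lift f.2.unop) ▷ W =
      (λ_ (R ⊗ W)).hom ≫ ArrowCat.lift (f.2.unop ▷ W.as)
    rw [← ArrowCat.lift_whiskerRight]
    simp

theorem opticSt_comp {X S Y R Z T : ArrowCat 𝒜 h𝒜} (V W : ArrowCat 𝒜 h𝒜)
    (x : (Optic.{w} A).El (X.as, op S.as) (Y.as, op R.as))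
    (y : (Optic.{w} A).El (Y.as, op R.as) (Z.as, op T.as)) :
    opticSt V W (opticComp x y) = opticComp (opticSt V W x) (opticSt V W y) := by
  obtain ⟨P, a, b, rfl⟩ := opticMk_surjective (h𝒜 := h𝒜) x
  obtain ⟨Q, a', b', rfl⟩ := opticMk_surjective (h𝒜 := h𝒜) y
  simp only [opticComp_opticMk, opticSt_opticMk]
  refine opticMk_congr ?_ ?_
  · monoidal
  · monoidal

/-- The representatives differ by the left unitor of the residuals. -/
theorem opticPure_comp {X S Y R Z T : ArrowCat 𝒜 h𝒜}
    (f : (X.as, op S.as) ⟶ (Y.as, op R.as))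
    (y : (Optic.{w} A).El (Y.as, op R.as) (Z.as, op T.as)) :
    opticComp (opticPure (h𝒜 := h𝒜) f) y = (Optic.{w} A).dimap f (𝟙 _) y := by
  obtain ⟨Q, a, b, rfl⟩ := opticMk_surjective (h𝒜 := h𝒜) y
  rw [opticPure, opticComp_opticMk, dimap_opticMk]
  refine opticMk_eq_of_slide (λ_ Q.as).hom ?_ ?_
  · change _ ≫ (λ_ Q).hom ▷ Z = _
    simp
  · change _ = (λ_ Q).hom ▷ T ≫ _
    simp

/-- The representatives differ by the right unitor of the residuals. -/
theorem opticComp_pure {X S Y R Z T : ArrowCat 𝒜 h𝒜}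
    (x : (Optic.{w} A).El (X.as, op S.as) (Y.as, op R.as))
    (f : (Y.as, op R.as) ⟶ (Z.as, op T.as)) :
    opticComp x (opticPure (h𝒜 := h𝒜) f) = (Optic.{w} A).dimap (𝟙 _) f x := by
  obtain ⟨P, a, b, rfl⟩ := opticMk_surjective (h𝒜 := h𝒜) x
  rw [opticPure, opticComp_opticMk, dimap_opticMk]
  refine opticMk_eq_of_slide (ρ_ P.as).hom ?_ ?_
  · change _ ≫ (ρ_ P).hom ▷ Z = _
    simp
  · change _ = (ρ_ P).hom ▷ T ≫ _
    simp

/-- The representatives differ by the associator of the residuals. -/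
theorem opticComp_assoc {X S Y R Z T V W : ArrowCat 𝒜 h𝒜}
    (x : (Optic.{w} A).El (X.as, op S.as) (Y.as, op R.as))
    (y : (Optic.{w} A).El (Y.as, op R.as) (Z.as, op T.as))
    (z : (Optic.{w} A).El (Z.as, op T.as) (V.as, op W.as)) :
    opticComp (opticComp (h𝒜 := h𝒜) x y) z = opticComp (h𝒜 := h𝒜) x (opticComp y z) := by
  obtain ⟨P, a, b, rfl⟩ := opticMk_surjective (h𝒜 := h𝒜) x
  obtain ⟨Q, a', b', rfl⟩ := opticMk_surjective (h𝒜 := h𝒜) y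
  obtain ⟨N, a'', b'', rfl⟩ := opticMk_surjective (h𝒜 := h𝒜) z
  simp only [opticComp_opticMk]
  refine opticMk_eq_of_slide (α_ P.as Q.as N.as).hom ?_ ?_
  · change _ ≫ (α_ P Q N).hom ▷ V = _
    monoidal
  · change _ = (α_ P Q N).hom ▷ W ≫ _
    monoidal

/-- The left strength of the arrow of optics. -/
def opticStL {X S Y R : ArrowCat 𝒜 h𝒜} (Z W : ArrowCat 𝒜 h𝒜)
    (x : (Optic.{w} A).El (X.as, op S.as) (Y.as, op R.as)) :
    (Optic.{w} A).El ((Z ⊗ X).as, op (W ⊗ S).as) ((Z ⊗ Y).as, op (W ⊗ R).as) :=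
  (Optic.{w} A).dimap (β_ (Z.as, op W.as) (X.as, op S.as)).hom
    (β_ (Y.as, op R.as) (Z.as, op W.as)).hom (opticSt Z W x)

theorem opticStL_opticMk {X S Y R P : ArrowCat 𝒜 h𝒜} (Z W : ArrowCat 𝒜 h𝒜) (a : X ⟶ P ⊗ Y)
    (b : P ⊗ R ⟶ S) :
    opticStL Z W (opticMk P a b) =
      opticMk P ((β_ Z X).hom ≫ (a ▷ Z ≫ (α_ P Y Z).hom) ≫ P ◁ (β_ Y Z).hom)
        (P ◁ (β_ W R).hom ≫ ((α_ P R W).inv ≫ b ▷ W) ≫ (β_ S W).hom) :=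
  dimap_opticMk (X' := Z ⊗ X) (S' := W ⊗ S) (Y' := Z ⊗ Y) (R' := W ⊗ R) _ _ _ _ _

/-- The representatives of the two parallel composites differ by the symmetry of their residuals
`P ⊗ Q` and `Q ⊗ P`. -/
theorem optic_comm {X S Y R X' S' Y' R' : ArrowCat 𝒜 h𝒜}
    (x : (Optic.{w} A).El (X.as, op S.as) (Y.as, op R.as))
    (y : (Optic.{w} A).El (X'.as, op S'.as) (Y'.as, op R'.as)) :
    opticComp (opticSt X' S' x) (opticStL Y R y) =
      opticComp (opticStL X S y) (opticSt Y' R' x) := by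
  obtain ⟨P, a, b, rfl⟩ := opticMk_surjective (h𝒜 := h𝒜) x
  obtain ⟨Q, a', b', rfl⟩ := opticMk_surjective (h𝒜 := h𝒜) y
  simp only [opticStL_opticMk, opticComp_opticMk, opticSt_opticMk]
  exact opticMk_eq_of_slide (β_ P.as Q.as).hom (forward_interchange a a')
    (backward_interchange b b').symm

/-- The arrow of optics. An object `U` of `C × Cᵒᵖ` is read as the pair of objects `U.1` and
`U.2.unop` of `ArrowCat 𝒜`. -/
def opticArrow (𝒜 : ArrowStr A) (h𝒜 : 𝒜.IsCommutative) : ArrowStr (Optic.{w} A) where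
  st {U V} Z := opticSt (h𝒜 := h𝒜) (X := ⟨U.1⟩) (S := ⟨U.2.unop⟩) (Y := ⟨V.1⟩) (R := ⟨V.2.unop⟩)
    ⟨Z.1⟩ ⟨Z.2.unop⟩
  st_natural {U U' V V'} Z f g x := opticSt_natural (h𝒜 := h𝒜) (X := ⟨U.1⟩) (S := ⟨U.2.unop⟩)
    (X' := ⟨U'.1⟩) (S' := ⟨U'.2.unop⟩) (Y := ⟨V.1⟩) (R := ⟨V.2.unop⟩) (Y' := ⟨V'.1⟩)
    (R' := ⟨V'.2.unop⟩) ⟨Z.1⟩ ⟨Z.2.unop⟩ f g x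
  st_dinatural {U V Z Z'} h x := opticSt_dinatural (h𝒜 := h𝒜) (X := ⟨U.1⟩) (S := ⟨U.2.unop⟩)
    (Y := ⟨V.1⟩) (R := ⟨V.2.unop⟩) (Z := ⟨Z.1⟩) (W := ⟨Z.2.unop⟩) (Z' := ⟨Z'.1⟩)
    (W' := ⟨Z'.2.unop⟩) h x
  st_assoc {U V} Z Z' x := opticSt_assoc (h𝒜 := h𝒜) (X := ⟨U.1⟩) (S := ⟨U.2.unop⟩)
    (Y := ⟨V.1⟩) (R := ⟨V.2.unop⟩) ⟨Z.1⟩ ⟨Z.2.unop⟩ ⟨Z'.1⟩ ⟨Z'.2.unop⟩ x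
  st_unit {U V} x := opticSt_unit (h𝒜 := h𝒜) (X := ⟨U.1⟩) (S := ⟨U.2.unop⟩)
    (Y := ⟨V.1⟩) (R := ⟨V.2.unop⟩) x
  pure {U V} f := opticPure (h𝒜 := h𝒜) (X := ⟨U.1⟩) (S := ⟨U.2.unop⟩)
    (Y := ⟨V.1⟩) (R := ⟨V.2.unop⟩) f
  pure_natural {U U' V V'} f k g := opticPure_natural (h𝒜 := h𝒜) (X := ⟨U.1⟩) (S := ⟨U.2.unop⟩)
    (X' := ⟨U'.1⟩) (S' := ⟨U'.2.unop⟩) (Y := ⟨V.1⟩) (R := ⟨V.2.unop⟩) (Y' := ⟨V'.1⟩)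
    (R' := ⟨V'.2.unop⟩) f k g
  comp {U V W} x y := opticComp (h𝒜 := h𝒜) (X := ⟨U.1⟩) (S := ⟨U.2.unop⟩)
    (Y := ⟨V.1⟩) (R := ⟨V.2.unop⟩) (Z := ⟨W.1⟩) (T := ⟨W.2.unop⟩) x y
  comp_natural {U U' V W W'} f g x y := opticComp_natural (h𝒜 := h𝒜) (X := ⟨U.1⟩)
    (S := ⟨U.2.unop⟩) (X' := ⟨U'.1⟩) (S' := ⟨U'.2.unop⟩) (Y := ⟨V.1⟩) (R := ⟨V.2.unop⟩)
    (Z := ⟨W.1⟩) (T := ⟨W.2.unop⟩) (Z' := ⟨W'.1⟩) (T' := ⟨W'.2.unop⟩) f g x y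
  comp_dinatural {U V V' W} h x y := opticComp_dinatural (h𝒜 := h𝒜) (X := ⟨U.1⟩)
    (S := ⟨U.2.unop⟩) (Y := ⟨V.1⟩) (R := ⟨V.2.unop⟩) (Y' := ⟨V'.1⟩) (R' := ⟨V'.2.unop⟩)
    (Z := ⟨W.1⟩) (T := ⟨W.2.unop⟩) h x y
  st_pure {U V} Z f := opticSt_pure (h𝒜 := h𝒜) (X := ⟨U.1⟩) (S := ⟨U.2.unop⟩)
    (Y := ⟨V.1⟩) (R := ⟨V.2.unop⟩) ⟨Z.1⟩ ⟨Z.2.unop⟩ f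
  st_comp {U V W} Z x y := opticSt_comp (h𝒜 := h𝒜) (X := ⟨U.1⟩) (S := ⟨U.2.unop⟩)
    (Y := ⟨V.1⟩) (R := ⟨V.2.unop⟩) (Z := ⟨W.1⟩) (T := ⟨W.2.unop⟩) ⟨Z.1⟩ ⟨Z.2.unop⟩ x y
  pure_comp {U V W} f y := opticPure_comp (h𝒜 := h𝒜) (X := ⟨U.1⟩) (S := ⟨U.2.unop⟩)
    (Y := ⟨V.1⟩) (R := ⟨V.2.unop⟩) (Z := ⟨W.1⟩) (T := ⟨W.2.unop⟩) f y
  comp_pure {U V W} x f := opticComp_pure (h𝒜 := h𝒜) (X := ⟨U.1⟩) (S := ⟨U.2.unop⟩)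
    (Y := ⟨V.1⟩) (R := ⟨V.2.unop⟩) (Z := ⟨W.1⟩) (T := ⟨W.2.unop⟩) x f
  comp_assoc {U V W N} x y z := opticComp_assoc (h𝒜 := h𝒜) (X := ⟨U.1⟩) (S := ⟨U.2.unop⟩)
    (Y := ⟨V.1⟩) (R := ⟨V.2.unop⟩) (Z := ⟨W.1⟩) (T := ⟨W.2.unop⟩) (V := ⟨N.1⟩)
    (W := ⟨N.2.unop⟩) x y z

theorem opticArrow_isCommutative (𝒜 : ArrowStr A) (h𝒜 : 𝒜.IsCommutative) :
    (opticArrow 𝒜 h𝒜).IsCommutative := fun U V U' V' x y =>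
  optic_comm (h𝒜 := h𝒜) (X := ⟨U.1⟩) (S := ⟨U.2.unop⟩) (Y := ⟨V.1⟩) (R := ⟨V.2.unop⟩)
    (X' := ⟨U'.1⟩) (S' := ⟨U'.2.unop⟩) (Y' := ⟨V'.1⟩) (R' := ⟨V'.2.unop⟩) x y

end OpticLaws

end ProfArrow

theorem mainTheorem7 {C : Type u} [Category.{v} C] [MonoidalCategory C] [SymmetricCategory C]
    (A : ProfArrow.EndoProf.{max w u} C) (𝒜 : ProfArrow.ArrowStr A) (h𝒜 : 𝒜.IsCommutative) :
    ∃ 𝒪 : ProfArrow.ArrowStr (ProfArrow.Optic.{w} A),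
      𝒪.IsCommutative ∧
      -- the unit: `(f, g)` is sent to the class of `(pure (λ⁻¹ ∘ f), pure (g ∘ λ))`
      (∀ {X S Y R : C} (f : X ⟶ Y) (g : R ⟶ S),
        𝒪.pure (Prod.mkHom f g.op : (X, op S) ⟶ (Y, op R)) =
          ProfArrow.Optic.mk A (𝟙_ C)
            (𝒜.pure (f ≫ (λ_ Y).inv)) (𝒜.pure ((λ_ R).hom ≫ g))) ∧
      -- the composition, with residual the tensor product of the residuals
      (∀ {X S Y R Z T : C} (P Q : C) (a : A.El X (P ⊗ Y)) (b : A.El (P ⊗ R) S)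
          (a' : A.El Y (Q ⊗ Z)) (b' : A.El (Q ⊗ T) R),
        𝒪.comp (ProfArrow.Optic.mk A P a b) (ProfArrow.Optic.mk A Q a' b') =
          ProfArrow.Optic.mk A (P ⊗ Q)
            (A.dimap (𝟙 X) (α_ P Q Z).inv (𝒜.comp a (𝒜.stL P a')))
            (A.dimap (α_ P Q T).hom (𝟙 S) (𝒜.comp (𝒜.stL P b') b))) ∧
      -- the strength, with unchanged residual
      (∀ {X S Y R : C} (Z W P : C) (a : A.El X (P ⊗ Y)) (b : A.El (P ⊗ R) S),
        𝒪.st ((Z, op W) : C × Cᵒᵖ) (ProfArrow.Optic.mk A P a b) =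
          (ProfArrow.Optic.mk A P
            (A.dimap (𝟙 (X ⊗ Z)) (α_ P Y Z).hom (𝒜.st Z a))
            (A.dimap (α_ P R W).inv (𝟙 (S ⊗ W)) (𝒜.st W b)) :
            (ProfArrow.Optic.{w} A).El (X ⊗ Z, op (S ⊗ W)) (Y ⊗ Z, op (R ⊗ W)))) := by
  refine ⟨ProfArrow.opticArrow 𝒜 h𝒜, ProfArrow.opticArrow_isCommutative 𝒜 h𝒜, ?_, ?_, ?_⟩
  · intro X S Y R f g
    rw [← 𝒜.pure_comp_pure, ← 𝒜.pure_comp_pure]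
    rfl
  -- In `ArrowCat 𝒜`, the action of a morphism of `C` is a composition by definition; what remains
  -- is bracketing.
  · intro X S Y R Z T P Q a b a' b'
    rw [← 𝒜.comp_pure, ← 𝒜.pure_comp, 𝒜.comp_assoc]
    rfl
  · intro X S Y R Z W P a b
    rw [← 𝒜.comp_pure, ← 𝒜.pure_comp]
    rfl
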